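/- Let $p$ be a prime and $s>1$ an integer. Define $l_0=1$ and $l_n\in\mathbb{Q}[v_1,v_2,\dots]$ for $n\ge 1$ by Hazewinkel's recursion $p\,l_n=\sum_{k=0}^{n-1} l_k\,v_{n-k}^{p^k}$, and put $\log_{BP}(x)=\sum_{n\ge 0} l_n x^{p^n}$. The formal group law $F_{BP}(x,y)=\log_{BP}^{-1}(\log_{BP}(x)+\log_{BP}(y))$ of Brown–Peterson cohomology has coefficients in $BP_*=\mathbb{Z}_{(p)}[v_1,v_2,\dots]$. Let $F(x,y)$ be the formal group law of mod $p$ Morava $K$-theory $K^*(s)$, i.e. the power series over $\mathbb{F}_p[v_s,v_s^{-1}]$ obtained from $F_{BP}$ by putting $v_i=0$ for all $i\ne s$ and reducing modulo $p$. Then, in $\mathbb{F}_p[v_s,v_s^{-1}][[x,y]]$, $$F(x,y)\equiv x+y-v_s\sum_{0<j<p}\frac1p\binom pj\,\bigl(x^{p^{s-1}}\bigr)^{j}\bigl(y^{p^{s-1}}\bigr)^{p-j}$$ modulo the ideal generated by $x^{p^{2(s-1)}}$, and likewise modulo the ideal generated by $y^{p^{2(s-1)}}$. (Here $\frac1p\binom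 pj$ is an integer, reduced modulo $p$.) -/

import Mathlib

theorem PowerSeries.coeff_subst_of_degree_one {R τ : Type*} [CommRing R] (f : PowerSeries R)
    {h : MvPowerSeries τ R} (hh : h.constantCoeff = 0) (e : τ →₀ ℕ) (he : e.degree = 1) :
    (f.subst h).coeff e = f.coeff 1 * h.coeff e := by
  rw [PowerSeries.coeff_subst (PowerSeries.HasSubst.of_constantCoeff_zero hh),
    finsum_eq_single _ 1]
  · simp
  · intro d hd
    rcases d with _ | _ | d
    · classical
      have : e ≠ 0 := by rintro rfl; simp at he
      simp [MvPowerSeries.coeff_one, this]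
    · exact absurd rfl hd
    · rw [MvPowerSeries.coeff_of_lt_order, smul_zero]
      refine lt_of_lt_of_le ?_ (MvPowerSeries.le_order_pow_of_constantCoeff_eq_zero _ hh)
      rw [he]
      exact_mod_cast (by omega : 1 < d + 1 + 1)

open MvPowerSeries in
theorem FormalGroup.subst_ofLog_aux {R τ : Type*} [CommRing R] (f g : PowerSeries R)
    (h0 : f.constantCoeff = 0) (a b : MvPowerSeries τ R)
    (ha : a.constantCoeff = 0) (hb : b.constantCoeff = 0) :
    MvPowerSeries.subst ![a, b] (g.subst (f.subst (X 0 : MvPowerSeries (Fin 2) R) +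
      f.subst (X 1 : MvPowerSeries (Fin 2) R))) = g.subst (f.subst a + f.subst b) := by
  have hX (i : Fin 2) : PowerSeries.HasSubst (X i : MvPowerSeries (Fin 2) R) :=
    PowerSeries.HasSubst.X i
  have hab : MvPowerSeries.HasSubst ![a, b] :=
    hasSubst_of_constantCoeff_zero fun s => by fin_cases s <;> simpa
  have hs (i : Fin 2) : (f.subst (X i : MvPowerSeries (Fin 2) R)).constantCoeff = 0 :=
    PowerSeries.constantCoeff_subst_eq_zero (by simp) f h0
  have hg : PowerSeries.HasSubst (f.subst (X 0 : MvPowerSeries (Fin 2) R) +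
      f.subst (X 1 : MvPowerSeries (Fin 2) R)) :=
    PowerSeries.HasSubst.of_constantCoeff_zero (by simp [hs])
  have key (i : Fin 2) : MvPowerSeries.subst ![a, b] (f.subst (X i : MvPowerSeries (Fin 2) R))
      = f.subst (![a, b] i) := by
    rw [PowerSeries.subst, MvPowerSeries.subst_comp_subst_apply (hX i).const hab]
    simp only [MvPowerSeries.subst_X hab]
    rfl
  conv_lhs => rw [PowerSeries.subst]
  rw [MvPowerSeries.subst_comp_subst_apply hg.const hab, MvPowerSeries.subst_add hab,
    key 0, key 1]
  rfl

theorem PowerSeries.subst_subst_substInvOfIsUnit {R τ : Type*} [CommRing R] (f : PowerSeries R)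
    (h0 : f.constantCoeff = 0) (h1 : IsUnit (f.coeff 1)) (c : MvPowerSeries τ R)
    (hc : c.constantCoeff = 0) : f.subst ((f.substInvOfIsUnit h1).subst c) = c := by
  rw [← PowerSeries.subst_comp_subst_apply (PowerSeries.HasSubst.substInvOfIsUnit f h1)
    (PowerSeries.HasSubst.of_constantCoeff_zero hc),
    PowerSeries.subst_substInvOfIsUnit_right f h0 h1,
    PowerSeries.subst_X (PowerSeries.HasSubst.of_constantCoeff_zero hc)]

open MvPowerSeries in
/-- The formal group law `F(x, y) = f⁻¹(f(x) + f(y))` with logarithm `f(x) = x + ⋯`. -/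
noncomputable def FormalGroup.ofLog {R : Type*} [CommRing R] (f : PowerSeries R)
    (h0 : f.constantCoeff = 0) (h1 : IsUnit (f.coeff 1)) : FormalGroup R where
  toPowerSeries := (f.substInvOfIsUnit h1).subst
    (f.subst (X 0 : MvPowerSeries (Fin 2) R) + f.subst (X 1 : MvPowerSeries (Fin 2) R))
  zero_constantCoeff := by
    apply PowerSeries.constantCoeff_subst_eq_zero
    · rw [map_add, PowerSeries.constantCoeff_subst_eq_zero (by simp) f h0,
        PowerSeries.constantCoeff_subst_eq_zero (by simp) f h0, _root_.add_zero]
    · exact PowerSeries.constantCoeff_substInvOfIsUnit f h1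
  lin_coeff_X := by
    rw [PowerSeries.coeff_subst_of_degree_one _ (by
        rw [map_add, PowerSeries.constantCoeff_subst_eq_zero (by simp) f h0,
          PowerSeries.constantCoeff_subst_eq_zero (by simp) f h0, _root_.add_zero]) _ (by simp),
      map_add, PowerSeries.coeff_subst_of_degree_one _ (by simp) _ (by simp),
      PowerSeries.coeff_subst_of_degree_one _ (by simp) _ (by simp)]
    simp [coeff_index_single_X]
  lin_coeff_Y := by
    rw [PowerSeries.coeff_subst_of_degree_one _ (by
        rw [map_add, PowerSeries.constantCoeff_subst_eq_zero (by simp) f h0,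
          PowerSeries.constantCoeff_subst_eq_zero (by simp) f h0, _root_.add_zero]) _ (by simp),
      map_add, PowerSeries.coeff_subst_of_degree_one _ (by simp) _ (by simp),
      PowerSeries.coeff_subst_of_degree_one _ (by simp) _ (by simp)]
    simp [coeff_index_single_X]
  assoc := by
    set E := f.substInvOfIsUnit h1
    set F := E.subst (f.subst (X 0 : MvPowerSeries (Fin 2) R) + f.subst (X 1 : MvPowerSeries (Fin 2) R)) with hF
    have h {τ : Type} (a b : MvPowerSeries τ R) (ha : a.constantCoeff = 0)
        (hb : b.constantCoeff = 0) : F.subst ![a, b] = E.subst (f.subst a + f.subst b) :=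
      FormalGroup.subst_ofLog_aux f E h0 a b ha hb
    have hc {τ : Type} (a b : MvPowerSeries τ R) (ha : a.constantCoeff = 0)
        (hb : b.constantCoeff = 0) : (f.subst a + f.subst b).constantCoeff = 0 := by
      rw [map_add, PowerSeries.constantCoeff_subst_eq_zero ha f h0,
        PowerSeries.constantCoeff_subst_eq_zero hb f h0, _root_.add_zero]
    have hz {τ : Type} (a b : MvPowerSeries τ R) (ha : a.constantCoeff = 0)
        (hb : b.constantCoeff = 0) : (E.subst (f.subst a + f.subst b)).constantCoeff = 0 :=
      PowerSeries.constantCoeff_subst_eq_zero (hc a b ha hb) _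
        (PowerSeries.constantCoeff_substInvOfIsUnit f h1)
    have hl {τ : Type} (a b : MvPowerSeries τ R) (ha : a.constantCoeff = 0)
        (hb : b.constantCoeff = 0) :
        f.subst (E.subst (f.subst a + f.subst b)) = f.subst a + f.subst b :=
      PowerSeries.subst_subst_substInvOfIsUnit f h0 h1 _ (hc a b ha hb)
    rw [h (X 0) (X 1) (by simp) (by simp), h (X 1) (X 2) (by simp) (by simp),
      h _ _ (hz _ _ (by simp) (by simp)) (by simp), h _ _ (by simp) (hz _ _ (by simp) (by simp)),
      hl _ _ (by simp) (by simp), hl _ _ (by simp) (by simp), _root_.add_assoc]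

open MvPowerSeries in
theorem FormalGroup.log_subst_ofLog {R : Type*} [CommRing R] (f : PowerSeries R)
    (h0 : f.constantCoeff = 0) (h1 : IsUnit (f.coeff 1)) :
    f.subst (FormalGroup.ofLog f h0 h1).toPowerSeries =
      f.subst (X 0 : MvPowerSeries (Fin 2) R) + f.subst (X 1 : MvPowerSeries (Fin 2) R) := by
  refine PowerSeries.subst_subst_substInvOfIsUnit f h0 h1 _ ?_
  rw [map_add, PowerSeries.constantCoeff_subst_eq_zero (by simp) f h0,
    PowerSeries.constantCoeff_subst_eq_zero (by simp) f h0, _root_.add_zero]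

open MvPolynomial in
/-- The generator `v_n` of the polynomial ring `R[v_1, v_2, …]`; it is only used for `n ≥ 1`. -/
noncomputable def BP.v (R : Type*) [CommRing R] (n : ℕ) : MvPolynomial ℕ+ R := X n.toPNat'

open MvPolynomial in
/-- The coefficients `l_n` of the logarithm of `BP`, given by `l_0 = 1` and Hazewinkel's recursion
`p l_n = v_n + v_{n-1}^p l_1 + ⋯ + v_1^{p^{n-1}} l_{n-1}`. -/
noncomputable def BP.logCoeff (p : ℕ) : ℕ → MvPolynomial ℕ+ ℚ
  | 0 => 1
  | n + 1 => C (1 / (p : ℚ)) *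
      ∑ k : Fin (n + 1), BP.logCoeff p k * BP.v ℚ (n + 1 - k) ^ p ^ (k : ℕ)

/-- The logarithm `log_BP(x) = x + l_1 x^p + l_2 x^{p^2} + ⋯`. -/
noncomputable def BP.log (p : ℕ) : PowerSeries (MvPolynomial ℕ+ ℚ) :=
  PowerSeries.mk fun m => if m = p ^ Nat.log p m then BP.logCoeff p (Nat.log p m) else 0

theorem BP.constantCoeff_log (p : ℕ) [Fact p.Prime] : (BP.log p).constantCoeff = 0 := by
  rw [← PowerSeries.coeff_zero_eq_constantCoeff_apply]
  simp [BP.log]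

theorem BP.isUnit_coeff_one_log (p : ℕ) : IsUnit ((BP.log p).coeff 1) := by
  simp [BP.log, BP.logCoeff]

namespace BP
open MvPolynomial

theorem logCoeff_eq (p n : ℕ) (hn : 0 < n) : logCoeff p n =
    C (1 / (p : ℚ)) * ∑ k ∈ Finset.range n, logCoeff p k * v ℚ (n - k) ^ p ^ k := by
  obtain ⟨n, rfl⟩ := Nat.exists_eq_succ_of_ne_zero hn.ne'
  rw [logCoeff, Finset.sum_range]

theorem logCoeff_eq' (p n : ℕ) (hn : 0 < n) : logCoeff p n =
    ∑ i ∈ Finset.Icc 1 n, C (1 / (p : ℚ)) * v ℚ i * expand (p ^ i) (logCoeff p (n - i)) := by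
  induction n using Nat.strong_induction_on with
  | _ n ih =>
  have h1 : logCoeff p n = C (1 / (p : ℚ)) * v ℚ n + ∑ k ∈ Finset.Ico 1 n, ∑ i ∈ Finset.Icc 1 k,
      C (1 / (p : ℚ)) * v ℚ i * (C (1 / (p : ℚ)) *
        (expand (p ^ i) (logCoeff p (k - i)) * v ℚ (n - k) ^ p ^ k)) := by
    rw [logCoeff_eq p n hn, Finset.range_eq_Ico, Finset.sum_eq_sum_Ico_succ_bot hn, mul_add]
    congr 1
    · simp [logCoeff]
    · rw [Finset.mul_sum]
      refine Finset.sum_congr rfl fun k hk => ?_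
      rw [Finset.mem_Ico] at hk
      rw [ih k (by omega) (by omega), Finset.sum_mul, Finset.mul_sum]
      refine Finset.sum_congr rfl fun i hi => by ring
  have h2 : ∑ i ∈ Finset.Icc 1 n, C (1 / (p : ℚ)) * v ℚ i * expand (p ^ i) (logCoeff p (n - i))
      = C (1 / (p : ℚ)) * v ℚ n + ∑ i ∈ Finset.Ico 1 n, ∑ k ∈ Finset.Ico i n,
      C (1 / (p : ℚ)) * v ℚ i * (C (1 / (p : ℚ)) *
        (expand (p ^ i) (logCoeff p (k - i)) * v ℚ (n - k) ^ p ^ k)) := by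
    rw [← Finset.Ico_add_one_right_eq_Icc, Finset.sum_Ico_succ_top hn, add_comm]
    congr 1
    · simp [logCoeff]
    · refine Finset.sum_congr rfl fun i hi => ?_
      rw [Finset.mem_Ico] at hi
      rw [← Finset.mul_sum, ← Finset.mul_sum, Finset.sum_Ico_eq_sum_range,
        logCoeff_eq p (n - i) (by omega)]
      congr 1
      rw [map_mul, expand_C, map_sum]
      congr 1
      refine Finset.sum_congr rfl fun k hk => ?_
      rw [map_mul, map_pow, Nat.add_sub_cancel_left, v, expand_X, ← pow_mul, ← pow_add, v,
        Nat.sub_sub]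
  rw [h1, h2]
  congr 1
  refine Finset.sum_comm' fun k i => ?_
  simp only [Finset.mem_Ico, Finset.mem_Icc]
  omega

theorem sum_logCoeff_mul {P : Type*} [CommRing P] (f : MvPolynomial ℕ+ ℚ →+* P) (p n : ℕ)
    (Z : ℕ → P) : ∑ k ∈ Finset.range (n + 1), f (logCoeff p k) * Z k =
      Z 0 + ∑ i ∈ Finset.Icc 1 n, f (C (1 / (p : ℚ)) * v ℚ i) *
        ∑ m ∈ Finset.range (n - i + 1), f (expand (p ^ i) (logCoeff p m)) * Z (i + m) := by
  rw [Finset.range_eq_Ico, Finset.sum_eq_sum_Ico_succ_bot (by omega)]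
  congr 1
  · simp [logCoeff]
  have h1 : ∑ k ∈ Finset.Ico (0 + 1) (n + 1), f (logCoeff p k) * Z k =
      ∑ k ∈ Finset.Ico (0 + 1) (n + 1), ∑ i ∈ Finset.Icc 1 k, f (C (1 / (p : ℚ)) * v ℚ i) *
        (f (expand (p ^ i) (logCoeff p (k - i))) * Z k) := by
    refine Finset.sum_congr rfl fun k hk => ?_
    rw [Finset.mem_Ico] at hk
    rw [logCoeff_eq' p k (by omega), map_sum, Finset.sum_mul]
    refine Finset.sum_congr rfl fun i hi => by rw [map_mul]; ring
  have h2 (i : ℕ) (hi : i ∈ Finset.Icc 1 n) : f (C (1 / (p : ℚ)) * v ℚ i) *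
        ∑ m ∈ Finset.range (n - i + 1), f (expand (p ^ i) (logCoeff p m)) * Z (i + m) =
      ∑ k ∈ Finset.Ico i (n + 1), f (C (1 / (p : ℚ)) * v ℚ i) *
        (f (expand (p ^ i) (logCoeff p (k - i))) * Z k) := by
    rw [Finset.mem_Icc] at hi
    rw [← Finset.mul_sum, Finset.sum_Ico_eq_sum_range, Nat.sub_add_comm hi.2]
    simp
  rw [h1, Finset.sum_congr rfl h2]
  refine Finset.sum_comm' fun k i => ?_
  simp only [Finset.mem_Ico, Finset.mem_Icc]
  omega

theorem pow_mul_logCoeff_mem (p n : ℕ) [Fact p.Prime] :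
    C ((p : ℚ) ^ n) * logCoeff p n ∈ (MvPolynomial.map (σ := ℕ+) (Int.castRingHom ℚ)).range := by
  have hp : (p : ℚ) ≠ 0 := by exact_mod_cast (Fact.out : p.Prime).ne_zero
  have hC (k : ℕ) : (C ((p : ℚ) ^ k) : MvPolynomial ℕ+ ℚ) ∈
      (MvPolynomial.map (σ := ℕ+) (Int.castRingHom ℚ)).range := ⟨C ((p : ℤ) ^ k), by simp⟩
  induction n using Nat.strong_induction_on with
  | _ n ih =>
  rcases Nat.eq_zero_or_pos n with rfl | hn
  · simp [logCoeff]
  rw [logCoeff_eq p n hn, ← mul_assoc, ← C_mul, Finset.mul_sum]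
  refine Subring.sum_mem _ fun k hk => ?_
  rw [Finset.mem_range] at hk
  have : (p : ℚ) ^ n * (1 / p) = p ^ (n - 1 - k) * p ^ k := by
    rw [← pow_add, show n = n - 1 - k + k + 1 by omega, pow_succ]
    field_simp
    congr 1
    omega
  have hv : v ℚ (n - k) ∈ (MvPolynomial.map (σ := ℕ+) (Int.castRingHom ℚ)).range :=
    ⟨X (n - k).toPNat', by simp [v]⟩
  rw [this, C_mul, mul_assoc, ← mul_assoc (C ((p : ℚ) ^ k))]
  exact mul_mem (hC _) (mul_mem (ih k hk) (pow_mem hv _))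
end BP

namespace BP
open MvPowerSeries

theorem order_subst_log_sub (p n : ℕ) [Fact p.Prime]
    (h : MvPowerSeries (Fin 2) (MvPolynomial ℕ+ ℚ)) (hh : h.constantCoeff = 0) :
    ((p ^ (n + 1) : ℕ) : ℕ∞) ≤ order ((log p).subst h -
      ∑ k ∈ Finset.range (n + 1), C (logCoeff p k) * h ^ p ^ k) := by
  have hp : 1 < p := (Fact.out : p.Prime).one_lt
  have hs : PowerSeries.HasSubst h := PowerSeries.HasSubst.of_constantCoeff_zero hh
  have key : (PowerSeries.X : PowerSeries (MvPolynomial ℕ+ ℚ)) ^ p ^ (n + 1) ∣ log p -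
      ∑ k ∈ Finset.range (n + 1), PowerSeries.C (logCoeff p k) * PowerSeries.X ^ p ^ k := by
    rw [PowerSeries.X_pow_dvd_iff]
    intro m hm
    simp only [map_sub, map_sum, PowerSeries.coeff_C_mul, PowerSeries.coeff_X_pow, log,
      PowerSeries.coeff_mk, mul_ite, mul_one, mul_zero]
    split_ifs with hk
    · have hlt : Nat.log p m < n + 1 := by
        rw [hk] at hm
        exact (Nat.pow_lt_pow_iff_right hp).1 hm
      rw [Finset.sum_eq_single (Nat.log p m), if_pos hk, sub_self]
      · intro b _ hb
        rw [if_neg]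
        intro h'
        rw [h', Nat.log_pow hp] at hb
        exact hb rfl
      · intro h'
        exact absurd (Finset.mem_range.2 hlt) h'
    · rw [zero_sub, neg_eq_zero]
      refine Finset.sum_eq_zero fun k _ => if_neg ?_
      rintro rfl
      rw [Nat.log_pow hp] at hk
      exact hk rfl
  obtain ⟨r, hr⟩ := key
  have h2 := congrArg (PowerSeries.substAlgHom hs) hr
  simp only [map_sub, map_sum, map_mul, map_pow, PowerSeries.substAlgHom_X] at h2
  rw [PowerSeries.coe_substAlgHom] at h2
  simp only [PowerSeries.subst_C] at h2
  rw [h2]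
  refine le_trans ?_ le_order_mul
  exact le_trans (le_order_pow_of_constantCoeff_eq_zero _ hh) le_self_add

/-- The ring endomorphism `v_n ↦ v_n ^ q`, `x ↦ x ^ q` of `R[v_1, v_2, …][[x, y]]`. -/
noncomputable def lift (R : Type*) [CommRing R] (q : ℕ) (hq : q ≠ 0) :
    MvPowerSeries (Fin 2) (MvPolynomial ℕ+ R) →+* MvPowerSeries (Fin 2) (MvPolynomial ℕ+ R) :=
  (MvPowerSeries.map ((MvPolynomial.expand q : MvPolynomial ℕ+ R →ₐ[R] MvPolynomial ℕ+ R) :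
      MvPolynomial ℕ+ R →+* MvPolynomial ℕ+ R)).comp
    (MvPowerSeries.expand (σ := Fin 2) (R := MvPolynomial ℕ+ R) q hq : _ →+* _)

theorem lift_apply {R : Type*} [CommRing R] (q : ℕ) (hq : q ≠ 0)
    (f : MvPowerSeries (Fin 2) (MvPolynomial ℕ+ R)) : lift R q hq f =
      (MvPowerSeries.expand q hq f).map ((MvPolynomial.expand q :
        MvPolynomial ℕ+ R →ₐ[R] MvPolynomial ℕ+ R) : MvPolynomial ℕ+ R →+* MvPolynomial ℕ+ R) :=
  rfl

theorem order_lift {R : Type*} [CommRing R] (q : ℕ) (hq : q ≠ 0) (k : ℕ)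
    (f : MvPowerSeries (Fin 2) (MvPolynomial ℕ+ R)) (hf : (k : ℕ∞) ≤ f.order) :
    ((q * k : ℕ) : ℕ∞) ≤ (lift R q hq f).order := by
  rw [lift_apply]
  refine le_trans ?_ (le_order_map _)
  rw [order_expand, nsmul_eq_mul, Nat.cast_mul]
  gcongr

theorem lift_map {R S : Type*} [CommRing R] [CommRing S] (g : R →+* S) (q : ℕ) (hq : q ≠ 0)
    (f : MvPowerSeries (Fin 2) (MvPolynomial ℕ+ R)) :
    lift S q hq (f.map (MvPolynomial.map g)) = (lift R q hq f).map (MvPolynomial.map g) := by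
  rw [lift_apply, lift_apply, ← map_expand, MvPowerSeries.map_map, MvPowerSeries.map_map]
  congr 2
  refine RingHom.ext fun x => ?_
  simp

theorem lift_X {R : Type*} [CommRing R] (q : ℕ) (hq : q ≠ 0) (i : Fin 2) :
    lift R q hq (X i) = X i ^ q := by
  simp [lift_apply]

theorem lift_C {R : Type*} [CommRing R] (q : ℕ) (hq : q ≠ 0) (a : MvPolynomial ℕ+ R) :
    lift R q hq (C a) = C (MvPolynomial.expand q a) := by
  simp [lift_apply, expand_C]

theorem dvd_lift_sub_pow (p i : ℕ) [Fact p.Prime] (hq : p ^ i ≠ 0)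
    (f : MvPowerSeries (Fin 2) (MvPolynomial ℕ+ ℤ)) :
    (p : MvPowerSeries (Fin 2) (MvPolynomial ℕ+ ℤ)) ∣ lift ℤ (p ^ i) hq f - f ^ p ^ i := by
  have hz (g : MvPolynomial ℕ+ (ZMod p)) : iterateFrobenius _ p i g =
      MvPolynomial.expand (p ^ i) g := by
    rw [iterateFrobenius_def, ← MvPolynomial.map_iterateFrobenius_expand]
    convert MvPolynomial.map_id _
    ext1 x
    simp [iterateFrobenius_def, ZMod.pow_card_pow]
  have h0 : (lift ℤ (p ^ i) hq f - f ^ p ^ i).map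
      (MvPolynomial.map (Int.castRingHom (ZMod p))) = 0 := by
    rw [map_sub, ← lift_map, map_pow, ← map_iterateFrobenius_expand p
      (Fact.out : p.Prime).ne_zero, sub_eq_zero]
    rw [lift_apply]
    congr 2
    exact RingHom.ext fun g => (hz g).symm
  have h1 (e : Fin 2 →₀ ℕ) : (p : MvPolynomial ℕ+ ℤ) ∣
      coeff e (lift ℤ (p ^ i) hq f - f ^ p ^ i) := by
    have := congrArg (coeff e) h0
    rw [coeff_map, map_zero, ← MvPolynomial.C_dvd_iff_zmod] at this
    simpa using this
  choose g hg using h1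
  refine ⟨(g : MvPowerSeries (Fin 2) (MvPolynomial ℕ+ ℤ)), ?_⟩
  ext1 e
  have h2 : (p : MvPowerSeries (Fin 2) (MvPolynomial ℕ+ ℤ)) = C (p : MvPolynomial ℕ+ ℤ) := by
    simp
  rw [hg, h2]
  exact (coeff_C_mul e g _).symm

end BP

namespace BP
open MvPowerSeries

theorem order_sub_of_log_eq (p n : ℕ) [hp : Fact p.Prime]
    (F : MvPowerSeries (Fin 2) (MvPolynomial ℕ+ ℚ)) (h0 : F.constantCoeff = 0)
    (hF : (log p).subst F = (log p).subst (X 0 : MvPowerSeries (Fin 2) (MvPolynomial ℕ+ ℚ)) +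
      (log p).subst (X 1 : MvPowerSeries (Fin 2) (MvPolynomial ℕ+ ℚ))) :
    ((p ^ (n + 1) : ℕ) : ℕ∞) ≤ order (F - (X 0 + X 1 + ∑ i ∈ Finset.Icc 1 n,
      C (MvPolynomial.C (1 / (p : ℚ)) * v ℚ i) * ∑ m ∈ Finset.range (n - i + 1),
        C (MvPolynomial.expand (p ^ i) (logCoeff p m)) *
          (lift ℚ (p ^ i) (pow_ne_zero i hp.out.ne_zero) F ^ p ^ m - (F ^ p ^ i) ^ p ^ m))) := by
  have hadd {N : ℕ∞} {a b : MvPowerSeries (Fin 2) (MvPolynomial ℕ+ ℚ)} (ha : N ≤ a.order)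
      (hb : N ≤ b.order) : N ≤ (a + b).order := le_trans (le_min ha hb) min_order_le_add
  have hsum {N : ℕ∞} (s : Finset ℕ) (a : ℕ → MvPowerSeries (Fin 2) (MvPolynomial ℕ+ ℚ))
      (ha : ∀ i ∈ s, N ≤ (a i).order) : N ≤ (∑ i ∈ s, a i).order :=
    Finset.sum_induction _ (fun x => N ≤ order x) (fun _ _ => hadd) (by simp) ha
  let D (k : ℕ) : MvPowerSeries (Fin 2) (MvPolynomial ℕ+ ℚ) :=
    ∑ m ∈ Finset.range (k + 1), C (logCoeff p m) * (F ^ p ^ m - X 0 ^ p ^ m - X 1 ^ p ^ m)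
  have hD (k : ℕ) : ((p ^ (k + 1) : ℕ) : ℕ∞) ≤ (D k).order := by
    have e0 := order_subst_log_sub p k F h0
    have e1 := order_subst_log_sub p k (X 0) (by simp)
    have e2 := order_subst_log_sub p k (X 1) (by simp)
    rw [← order_neg] at e0
    have := hadd (hadd e0 e1) e2
    convert this using 2
    simp only [D, mul_sub, Finset.sum_sub_distrib]
    rw [hF]
    ring
  have hS := sum_logCoeff_mul (C : MvPolynomial ℕ+ ℚ →+* MvPowerSeries (Fin 2) _) p n
    (fun m => F ^ p ^ m - X 0 ^ p ^ m - X 1 ^ p ^ m)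
  have hL (i : ℕ) : lift ℚ (p ^ i) (pow_ne_zero i hp.out.ne_zero) (D (n - i)) =
      ∑ m ∈ Finset.range (n - i + 1), C (MvPolynomial.expand (p ^ i) (logCoeff p m)) *
        (lift ℚ (p ^ i) (pow_ne_zero i hp.out.ne_zero) F ^ p ^ m
          - X 0 ^ p ^ (i + m) - X 1 ^ p ^ (i + m)) := by
    simp only [D, map_sum, map_mul, map_sub, map_pow, lift_X, lift_C, ← pow_mul, ← pow_add]
  have hE : F - (X 0 + X 1 + ∑ i ∈ Finset.Icc 1 n,
      C (MvPolynomial.C (1 / (p : ℚ)) * v ℚ i) * ∑ m ∈ Finset.range (n - i + 1),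
        C (MvPolynomial.expand (p ^ i) (logCoeff p m)) *
          (lift ℚ (p ^ i) (pow_ne_zero i hp.out.ne_zero) F ^ p ^ m - (F ^ p ^ i) ^ p ^ m))
      = D n + ∑ i ∈ Finset.Icc 1 n, -(C (MvPolynomial.C (1 / (p : ℚ)) * v ℚ i) *
        lift ℚ (p ^ i) (pow_ne_zero i hp.out.ne_zero) (D (n - i))) := by
    simp only [D] at hL ⊢
    rw [hS]
    simp only [hL, pow_zero, pow_one]
    rw [Finset.sum_neg_distrib, add_assoc (F - X 0 - X 1), ← sub_eq_add_neg,
      ← Finset.sum_sub_distrib, ← sub_sub, ← sub_sub, sub_eq_add_neg _ (Finset.sum _ _),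
      ← Finset.sum_neg_distrib]
    congr 1
    refine Finset.sum_congr rfl fun i _ => ?_
    rw [← mul_sub, ← mul_neg, ← Finset.sum_sub_distrib, ← Finset.sum_neg_distrib]
    congr 1
    refine Finset.sum_congr rfl fun m _ => ?_
    rw [← pow_mul, ← pow_add]
    ring
  rw [hE]
  refine hadd (hD n) (hsum _ _ fun i hi => ?_)
  rw [Finset.mem_Icc] at hi
  rw [order_neg]
  refine le_trans (le_trans ?_ (order_lift (p ^ i) (pow_ne_zero i hp.out.ne_zero) _ _
    (hD (n - i)))) (le_trans le_add_self le_order_mul)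
  rw [← pow_add]
  exact_mod_cast (le_of_eq (by congr 1; omega))

theorem order_pow_sub_pow {R : Type*} [CommRing R] (F G : MvPowerSeries (Fin 2) R)
    (hF : F.constantCoeff = 0) (hG : G.constantCoeff = 0) (N : ℕ) (h : (N : ℕ∞) ≤ (F - G).order)
    (q : ℕ) (hq : 2 ≤ q) : ((N + 1 : ℕ) : ℕ∞) ≤ (F ^ q - G ^ q).order := by
  rw [← Commute.mul_geom_sum₂ (Commute.all F G) q]
  refine le_trans ?_ le_order_mul
  rw [Nat.cast_add]
  refine add_le_add h ?_
  rw [Nat.cast_one, one_le_order_iff_constCoeff_eq_zero, map_sum]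
  refine Finset.sum_eq_zero fun i hi => ?_
  rw [Finset.mem_range] at hi
  rw [map_mul, map_pow, map_pow, hF, hG, ← pow_add, zero_pow (by omega)]

theorem order_pow_sub_pow' {R : Type*} [CommRing R] (F G : MvPowerSeries (Fin 2) R) (N : ℕ)
    (h : (N : ℕ∞) ≤ (F - G).order) (q : ℕ) : (N : ℕ∞) ≤ (F ^ q - G ^ q).order := by
  rw [← Commute.mul_geom_sum₂ (Commute.all F G) q]
  exact le_trans (le_trans h le_self_add) le_order_mul

theorem mem_range_map {σ R S : Type*} [CommRing R] [CommRing S] (g : R →+* S)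
    (f : MvPowerSeries σ S) (hf : ∀ e, coeff e f ∈ g.range) : f ∈ (MvPowerSeries.map g).range := by
  choose a ha using hf
  refine ⟨(a : MvPowerSeries σ R), ?_⟩
  ext1 e
  exact ha e

theorem C_mul_sub_mem (p i m : ℕ) [hp : Fact p.Prime]
    (G : MvPowerSeries (Fin 2) (MvPolynomial ℕ+ ℤ)) :
    C (MvPolynomial.C (1 / (p : ℚ)) * v ℚ i) *
      (C (MvPolynomial.expand (p ^ i) (logCoeff p m)) *
        (lift ℚ (p ^ i) (pow_ne_zero i hp.out.ne_zero)
          (G.map (MvPolynomial.map (Int.castRingHom ℚ))) ^ p ^ m -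
          (G.map (MvPolynomial.map (Int.castRingHom ℚ)) ^ p ^ i) ^ p ^ m)) ∈
      (MvPowerSeries.map (σ := Fin 2) (MvPolynomial.map (σ := ℕ+) (Int.castRingHom ℚ))).range := by
  have hp0 : (p : ℚ) ≠ 0 := by exact_mod_cast hp.out.ne_zero
  obtain ⟨g, hg⟩ := dvd_sub_pow_of_dvd_sub
    (dvd_lift_sub_pow p i (pow_ne_zero i hp.out.ne_zero) G) m
  obtain ⟨l, hl⟩ := pow_mul_logCoeff_mem p m
  refine ⟨C (v ℤ i * MvPolynomial.expand (p ^ i) l) * g, ?_⟩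
  have hg' := congrArg (MvPowerSeries.map (MvPolynomial.map (Int.castRingHom ℚ))) hg
  rw [map_sub, map_pow, map_pow, map_pow, ← lift_map] at hg'
  rw [hg', map_mul, map_mul (MvPowerSeries.map _) (_ ^ _), MvPowerSeries.map_C,
    map_mul (MvPolynomial.map _), MvPolynomial.map_expand, hl, ← mul_assoc, ← mul_assoc,
    ← map_mul C]
  congr 1
  have : (MvPowerSeries.map (MvPolynomial.map (Int.castRingHom ℚ)))
      ((p : MvPowerSeries (Fin 2) (MvPolynomial ℕ+ ℤ)) ^ (m + 1)) =
      C (MvPolynomial.C ((p : ℚ) ^ (m + 1))) := by simp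
  rw [this, ← map_mul]
  congr 1
  have h2 : (MvPolynomial.C ((p : ℚ) ^ (m + 1)) : MvPolynomial ℕ+ ℚ) * MvPolynomial.C (1 / (p : ℚ))
      = MvPolynomial.C ((p : ℚ) ^ m) := by
    rw [← MvPolynomial.C_mul, pow_succ]
    congr 1
    field_simp
  have h3 : MvPolynomial.map (Int.castRingHom ℚ) (v ℤ i) = v ℚ i := by simp [v]
  rw [map_mul, MvPolynomial.expand_C, ← h2, h3]
  ring

theorem coeff_mem_of_log_eq (p : ℕ) [hp : Fact p.Prime]
    (F : MvPowerSeries (Fin 2) (MvPolynomial ℕ+ ℚ)) (h0 : F.constantCoeff = 0)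
    (hF : (log p).subst F = (log p).subst (X 0 : MvPowerSeries (Fin 2) (MvPolynomial ℕ+ ℚ)) +
      (log p).subst (X 1 : MvPowerSeries (Fin 2) (MvPolynomial ℕ+ ℚ))) (e : Fin 2 →₀ ℕ) :
    coeff e F ∈ (MvPolynomial.map (σ := ℕ+) (Int.castRingHom ℚ)).range := by
  classical
  obtain ⟨N, hN⟩ : ∃ N, N = e.degree := ⟨_, rfl⟩
  induction N using Nat.strong_induction_on generalizing e with
  | _ N ih =>
  rcases Nat.eq_zero_or_pos N with rfl | hpos
  · have : e = 0 := (Finsupp.degree_eq_zero_iff e).1 hN.symm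
    rw [this, coeff_zero_eq_constantCoeff_apply, h0]
    exact zero_mem _
  let G' : MvPowerSeries (Fin 2) (MvPolynomial ℕ+ ℚ) := fun d =>
    if d.degree < N then coeff d F else 0
  have hG' (d) : coeff d G' = if d.degree < N then coeff d F else 0 := rfl
  have hG0 : G'.constantCoeff = 0 := by
    rw [← coeff_zero_eq_constantCoeff_apply, hG', coeff_zero_eq_constantCoeff_apply, h0, ite_self]
  obtain ⟨G, hG⟩ := mem_range_map (MvPolynomial.map (σ := ℕ+) (Int.castRingHom ℚ)) G' (by
    intro d
    rw [hG']
    split_ifs with hd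
    · exact ih _ hd d rfl
    · exact zero_mem _)
  have hFG : (N : ℕ∞) ≤ (F - G').order := by
    refine nat_le_order fun d hd => ?_
    rw [map_sub, hG', if_pos hd, sub_self]
  have hco {a b : MvPowerSeries (Fin 2) (MvPolynomial ℕ+ ℚ)}
      (hab : ((N + 1 : ℕ) : ℕ∞) ≤ (a - b).order) : coeff e a = coeff e b := by
    rw [← sub_eq_zero, ← map_sub]
    refine coeff_of_lt_order (lt_of_lt_of_le ?_ hab)
    rw [← hN]
    exact_mod_cast Nat.lt_succ_self N
  have hbig : N + 1 ≤ p ^ (N + 1) := (Nat.lt_pow_self hp.out.one_lt).le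
  have h1 := hco (le_trans (by exact_mod_cast hbig) (order_sub_of_log_eq p N F h0 hF))
  rw [h1, map_add, map_sum]
  refine add_mem ?_ (sum_mem fun i hi => ?_)
  · rw [map_add, coeff_X, coeff_X]
    refine add_mem ?_ ?_ <;> split_ifs
    exacts [one_mem _, zero_mem _, one_mem _, zero_mem _]
  rw [Finset.mem_Icc] at hi
  rw [Finset.mul_sum, map_sum]
  refine sum_mem fun m _ => ?_
  have h2i : 2 ≤ p ^ i := le_trans hp.out.two_le (Nat.le_self_pow (by omega) p)
  obtain ⟨g, hg⟩ := C_mul_sub_mem p i m G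
  rw [hG] at hg
  refine ⟨coeff e g, ?_⟩
  rw [← coeff_map, hg]
  symm
  apply hco
  rw [← mul_sub, ← mul_sub]
  refine le_trans (le_trans ?_ le_add_self) le_order_mul
  refine le_trans (le_trans ?_ le_add_self) le_order_mul
  rw [sub_sub_sub_comm, sub_eq_add_neg]
  refine le_trans (le_min ?_ ?_) min_order_le_add
  · apply order_pow_sub_pow'
    rw [← map_sub]
    refine le_trans ?_ (order_lift (p ^ i) (pow_ne_zero i hp.out.ne_zero) _ _ hFG)
    exact_mod_cast (by nlinarith : N + 1 ≤ p ^ i * N)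
  · rw [order_neg]
    apply order_pow_sub_pow'
    exact order_pow_sub_pow F G' h0 hG0 N hFG _ h2i

end BP

/-- The formal group law over `ℚ[v_1, v_2, …] = BP_* ⊗ ℚ` with logarithm `log_BP`. -/
noncomputable def BP.formalGroupRat (p : ℕ) [Fact p.Prime] : FormalGroup (MvPolynomial ℕ+ ℚ) :=
  FormalGroup.ofLog (BP.log p) (BP.constantCoeff_log p) (BP.isUnit_coeff_one_log p)

theorem MvPowerSeries.map_injective_of_injective {σ R S : Type*} [CommRing R] [CommRing S]
    {g : R →+* S} (hg : Function.Injective g) :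
    Function.Injective (MvPowerSeries.map (σ := σ) g) := by
  intro a b h
  ext1 e
  apply hg
  rw [← MvPowerSeries.coeff_map, h, MvPowerSeries.coeff_map]

theorem FormalGroup.map_injective_of_injective {R S : Type*} [CommRing R] [CommRing S]
    {g : R →+* S} (hg : Function.Injective g) :
    Function.Injective (fun F : FormalGroup R => F.map g) := by
  intro F G h
  refine FormalGroup.ext (MvPowerSeries.map_injective_of_injective hg ?_)
  exact congrArg FormalGroup.toPowerSeries h

open MvPowerSeries in
theorem FormalGroup.exists_map_eq {R S : Type*} [CommRing R] [CommRing S] {g : R →+* S}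
    (hg : Function.Injective g) (F : FormalGroup S)
    (h : ∀ e, MvPowerSeries.coeff e F.toPowerSeries ∈ g.range) :
    ∃ G : FormalGroup R, G.map g = F := by
  obtain ⟨G, hG⟩ := BP.mem_range_map g F.toPowerSeries h
  have h0 : G.constantCoeff = 0 := by
    apply hg
    rw [← MvPowerSeries.constantCoeff_map, hG, F.zero_constantCoeff, map_zero]
  refine ⟨⟨G, h0, ?_, ?_, ?_⟩, FormalGroup.ext hG⟩
  · apply hg
    rw [← MvPowerSeries.coeff_map, hG, F.lin_coeff_X, map_one]
  · apply hg
    rw [← MvPowerSeries.coeff_map, hG, F.lin_coeff_Y, map_one]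
  · apply MvPowerSeries.map_injective_of_injective hg
    have hv (a b : MvPowerSeries (Fin 3) R) : (fun i => (![a, b] i).map g) =
        ![a.map g, b.map g] := by
      ext1 i; fin_cases i <;> simp
    rw [MvPowerSeries.map_subst (HasSubst.cons_subst_zero_left (0 : Fin 3) 1 2 h0),
      MvPowerSeries.map_subst (HasSubst.cons_subst_zero_right (0 : Fin 3) 1 2 h0),
      hv, hv, MvPowerSeries.map_subst HasSubst.X_X, MvPowerSeries.map_subst HasSubst.X_X,
      hv, hv, hG]
    simpa using F.assoc

theorem BP.coeff_formalGroupRat_mem (p : ℕ) [Fact p.Prime] (e : Fin 2 →₀ ℕ) :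
    MvPowerSeries.coeff e (BP.formalGroupRat p).toPowerSeries ∈
      (MvPolynomial.map (σ := ℕ+) (Int.castRingHom ℚ)).range := by
  refine BP.coeff_mem_of_log_eq p _ (BP.formalGroupRat p).zero_constantCoeff ?_ e
  exact FormalGroup.log_subst_ofLog _ (BP.constantCoeff_log p) (BP.isUnit_coeff_one_log p)

instance BP.isPrime_span (p : ℕ) [hp : Fact p.Prime] : (Ideal.span {(p : ℤ)}).IsPrime :=
  (Ideal.span_singleton_prime (by exact_mod_cast hp.out.ne_zero)).2
    (Nat.prime_iff_prime_int.1 hp.out)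

/-- The ring `ℤ_(p)`. -/
abbrev BP.Zloc (p : ℕ) [hp : Fact p.Prime] : Type := Localization.AtPrime (Ideal.span {(p : ℤ)})

/-- The inclusion `ℤ_(p) → ℚ`. -/
noncomputable def BP.Zloc.toRat (p : ℕ) [Fact p.Prime] : BP.Zloc p →+* ℚ :=
  IsLocalization.lift (M := (Ideal.span {(p : ℤ)}).primeCompl) (g := Int.castRingHom ℚ)
    fun y => by
      have : (y : ℤ) ≠ 0 := fun h => y.2 (h ▸ Ideal.zero_mem _)
      simpa using this

/-- The reduction `ℤ_(p) → 𝔽_p`. -/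
noncomputable def BP.Zloc.toZMod (p : ℕ) [Fact p.Prime] : BP.Zloc p →+* ZMod p :=
  IsLocalization.lift (M := (Ideal.span {(p : ℤ)}).primeCompl) (g := Int.castRingHom (ZMod p))
    fun y => by
      have : ¬ (y : ℤ) ∈ Ideal.span {(p : ℤ)} := y.2
      rw [Ideal.mem_span_singleton, ← ZMod.intCast_zmod_eq_zero_iff_dvd] at this
      simpa using this

theorem BP.Zloc.toRat_injective (p : ℕ) [Fact p.Prime] :
    Function.Injective (BP.Zloc.toRat p) := by
  rw [BP.Zloc.toRat, IsLocalization.lift_injective_iff]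
  intro x y
  have := IsLocalization.injective (Localization.AtPrime (Ideal.span {(p : ℤ)}))
    (Ideal.primeCompl_le_nonZeroDivisors (Ideal.span {(p : ℤ)}))
  rw [this.eq_iff]
  simp

/-- The formal group law `F_BP` is defined over `BP_* = ℤ_(p)[v_1, v_2, …]`. -/
theorem BP.existsUnique_formalGroup (p : ℕ) [Fact p.Prime] :
    ∃! F : FormalGroup (MvPolynomial ℕ+ (BP.Zloc p)),
      F.map (MvPolynomial.map (BP.Zloc.toRat p)) = BP.formalGroupRat p := by
  have hinj : Function.Injective
      (MvPolynomial.map (σ := ℕ+) (BP.Zloc.toRat p)) :=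
    MvPolynomial.map_injective _ (BP.Zloc.toRat_injective p)
  refine existsUnique_of_exists_of_unique ?_ fun F G hF hG =>
    FormalGroup.map_injective_of_injective hinj (hF.trans hG.symm)
  refine FormalGroup.exists_map_eq hinj _ fun e => ?_
  obtain ⟨a, ha⟩ := BP.coeff_formalGroupRat_mem p e
  refine ⟨MvPolynomial.map (algebraMap ℤ (BP.Zloc p)) a, ?_⟩
  rw [← ha, MvPolynomial.map_map]
  congr 2
  exact RingHom.ext_int _ _

/-- The formal group law `F_BP` of Brown-Peterson cohomology over `BP_* = ℤ_(p)[v_1, v_2, …]`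
(with Hazewinkel's generators): the only one which over `BP_* ⊗ ℚ` has the logarithm `log_BP`. -/
noncomputable def BP.formalGroup (p : ℕ) [Fact p.Prime] :
    FormalGroup (MvPolynomial ℕ+ (BP.Zloc p)) :=
  (BP.existsUnique_formalGroup p).choose

/-- The formal group law of `G(s)` over `ℤ_(p)[v_s]`, obtained from `F_BP` by putting `v_i = 0`
for all `i ≠ s`. -/
noncomputable def GTheory.formalGroup (p s : ℕ) [Fact p.Prime] :
    FormalGroup (Polynomial (BP.Zloc p)) :=
  (BP.formalGroup p).map (MvPolynomial.eval₂Hom Polynomial.C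
    fun i : ℕ+ => if (i : ℕ) = s then Polynomial.X else 0)

/-- The coefficient ring `𝔽_p[v_s, v_s⁻¹]` of mod `p` Morava K-theory `K(s)`. -/
abbrev MoravaK.CoeffRing (p : ℕ) : Type := LaurentPolynomial (ZMod p)

/-- The generator `v_s` of `𝔽_p[v_s, v_s⁻¹]`. -/
noncomputable def MoravaK.v (p : ℕ) : MoravaK.CoeffRing p := LaurentPolynomial.T 1

/-- The formal group law of mod `p` Morava K-theory `K(s)`: the reduction modulo `p` of the formal
group law of `G(s)`. -/
noncomputable def MoravaK.formalGroup (p s : ℕ) [Fact p.Prime] :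
    FormalGroup (MoravaK.CoeffRing p) :=
  (GTheory.formalGroup p s).map (Polynomial.eval₂RingHom
    ((LaurentPolynomial.C : ZMod p →+* MoravaK.CoeffRing p).comp (BP.Zloc.toZMod p))
    (MoravaK.v p))

/-! Work over `ℤ[v_1, v_2, …]` with all `v_i`, `i ≠ s`, put to zero; this ring has no `p`-torsion,
so one can divide by `p`. Let `q = p ^ s`, and let `F'` be `F` with `v_s`, `x`, `y` replaced by
their `q`-th powers. Hazewinkel's functional equation gives `F = x + y + (v_s / p) ∑_m l_m' (F' ^ p
^ m - F ^ (q p ^ m))`, where `l_m'` is `l_m` with `v_s` replaced by `v_s ^ q`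
(`BP.coeff_map_formalGroupProj`).

As `F' ≡ F ^ q` mod `p`, the `m`-th difference is divisible by `p ^ (m + 1)`. Since `s > 1`, the
denominator of `l_m` divides `p ^ (m - 1)` for `m ≥ 1`. Hence only `m = 0` survives mod `p`: `F ≡ x
+ y + v_s D` with `p D = F' - F ^ q` (`BP.exists_formalGroupProj_eq`).

It remains to find `D` modulo `p` and `x ^ p ^ (2(s-1))`, that is, `F'` and `F ^ q` modulo `p ^ 2`
and this power. For `F'`, a weak estimate suffices: `F ≡ x + y` mod `(p ^ 2, x ^ p ^ (s-2))`
(`BP.formalGroupProj_sub_mem`), because the substitution multiplies the exponent of `x` by `q`. For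
`F ^ q`, first `D ≡ 0` mod `(p, x ^ p ^ (s-1))`, so `F ≡ x + y` modulo the same ideal, and taking
`q`-th powers gives `F ^ q ≡ (x + y) ^ q`. Finally `(x + y) ^ q ≡ x ^ q + y ^ q + p W` mod `p ^ 2`,
with `W` the sum in the theorem, so `D ≡ -W`. The argument is the same for `y`. -/

/-! ### Binomial coefficients and congruences between `p`-power powers -/

/-- The `p`-adic valuation of the binomial coefficient is `r - v_p(i)`, and `i < p ^ t` forces
`v_p(i) < t`. -/
theorem Nat.Prime.pow_dvd_choose_prime_pow {p : ℕ} (hp : p.Prime) {r t i : ℕ} (ht : t ≤ r)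
    (h0 : 0 < i) (hi : i < p ^ t) : p ^ (r - t + 1) ∣ (p ^ r).choose i := by
  have hir : i ≤ p ^ r := hi.le.trans (Nat.pow_le_pow_right hp.pos ht)
  rw [hp.pow_dvd_iff_le_factorization (Nat.choose_pos hir).ne',
    Nat.factorization_choose_prime_pow hp hir h0.ne']
  have : i.factorization p < t := by
    by_contra! h
    exact absurd (Nat.le_of_dvd h0 ((hp.pow_dvd_iff_le_factorization h0.ne').2 h)) hi.not_ge
  omega

/-- In the expansion of `(x ^ M * c + b) ^ p ^ r`, the terms of positive degree below `p ^ t` in `x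
^ M * c` have highly divisible binomial coefficients, and the others contain `x ^ (M * p ^ t)`. The
parameter `t` trades powers of `p` against powers of `x`. -/
theorem pow_prime_pow_sub_mem_span {R : Type*} [CommRing R] {p : ℕ} (hp : p.Prime) {r t : ℕ}
    (ht : t ≤ r) (M : ℕ) {a b x : R} (h : x ^ M ∣ a - b) :
    a ^ p ^ r - b ^ p ^ r ∈ Ideal.span {(p : R) ^ (r - t + 1), x ^ (M * p ^ t)} := by
  obtain ⟨c, hc⟩ := h
  rw [sub_eq_iff_eq_add] at hc
  rw [hc, (Commute.all _ _).add_pow, Finset.sum_range_succ', add_sub_assoc]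
  simp only [pow_zero, one_mul, Nat.sub_zero, Nat.choose_zero_right, Nat.cast_one, mul_one,
    sub_self, add_zero]
  refine Ideal.sum_mem _ fun i _ => ?_
  rcases lt_or_ge (i + 1) (p ^ t) with hi | hi
  · refine Ideal.mul_mem_left _ _ (Ideal.mem_of_dvd _ ?_ (Ideal.subset_span (Set.mem_insert _ _)))
    exact_mod_cast Nat.cast_dvd_cast (hp.pow_dvd_choose_prime_pow ht i.succ_pos hi)
  · refine Ideal.mul_mem_right _ _ (Ideal.mul_mem_right _ _ (Ideal.mem_of_dvd _ ?_
      (Ideal.subset_span (Set.mem_insert_of_mem _ rfl))))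
    rw [mul_pow, ← pow_mul]
    exact dvd_mul_of_dvd_left (pow_dvd_pow _ (Nat.mul_le_mul_left M hi)) _

theorem add_pow_prime_eq_sum_Ioo {R : Type*} [CommRing R] {p : ℕ} (hp : p.Prime) (a b : R) :
    (a + b) ^ p = a ^ p + b ^ p +
      p * ∑ j ∈ Finset.Ioo 0 p, ((p.choose j / p : ℕ) : R) * a ^ j * b ^ (p - j) := by
  rw [add_pow_prime_eq hp, mul_assoc, mul_assoc, Finset.mul_sum, Finset.mul_sum]
  congr 2
  refine Finset.sum_congr rfl fun j hj => ?_
  rw [Finset.mem_Ioo] at hj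
  obtain ⟨k, rfl⟩ := Nat.exists_eq_add_of_lt hj.1
  obtain ⟨l, hl⟩ := Nat.exists_eq_add_of_lt hj.2
  rw [show p - (0 + k + 1) - 1 = l by omega, show p - (0 + k + 1) = l + 1 by omega,
    show 0 + k + 1 - 1 = k by omega]
  ring

/-- Modulo `p ^ 2`, the binomial expansion of `(a + b) ^ p ^ (r + 1)` is that of
`(a ^ p ^ r + b ^ p ^ r) ^ p`. -/
theorem sq_dvd_add_pow_prime_pow_sub {R : Type*} [CommRing R] {p : ℕ} (hp : p.Prime) (r : ℕ)
    (a b : R) : (p : R) ^ 2 ∣ (a + b) ^ p ^ (r + 1) - (a ^ p ^ (r + 1) + b ^ p ^ (r + 1) +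
      p * ∑ j ∈ Finset.Ioo 0 p,
        ((p.choose j / p : ℕ) : R) * (a ^ p ^ r) ^ j * (b ^ p ^ r) ^ (p - j)) := by
  have h1 : (p : R) ∣ (a + b) ^ p ^ r - (a ^ p ^ r + b ^ p ^ r) := by
    obtain ⟨c, hc⟩ := exists_add_pow_prime_pow_eq hp a b r
    exact ⟨a * b * c, by rw [hc]; ring⟩
  -- A congruence mod `p` becomes one mod `p ^ 2` after raising to the `p`-th power.
  have h2 := dvd_sub_pow_of_dvd_sub h1 1
  rwa [pow_one, add_pow_prime_eq_sum_Ioo hp, ← pow_mul, ← pow_mul, ← pow_mul,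
    ← pow_succ] at h2

/-! ### Ideals `(n, X_i ^ M)` of power series, coefficient by coefficient -/

namespace MvPowerSeries

theorem natCast_dvd_iff {σ R : Type*} [CommRing R] (n : ℕ) (f : MvPowerSeries σ R) :
    (n : MvPowerSeries σ R) ∣ f ↔ ∀ e, (n : R) ∣ coeff e f := by
  have hn : (n : MvPowerSeries σ R) = C (n : R) := by simp
  constructor
  · rintro ⟨g, rfl⟩ e
    exact ⟨coeff e g, by rw [hn, coeff_C_mul]⟩
  · intro h
    choose g hg using h
    refine ⟨(g : MvPowerSeries σ R), ?_⟩
    ext1 e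
    rw [hg, hn]
    exact (coeff_C_mul e g _).symm

/-- Truncating `f` below degree `M` in `X i` splits it into a part divisible by `n` and a part
divisible by `X i ^ M`. All later estimates can thus be checked on single coefficients, where the
functional equation is a finite sum. -/
theorem mem_span_natCast_X_pow_iff {σ R : Type*} [CommRing R] (n M : ℕ) (i : σ)
    (f : MvPowerSeries σ R) : f ∈ Ideal.span {(n : MvPowerSeries σ R), X i ^ M} ↔
      ∀ e : σ →₀ ℕ, e i < M → (n : R) ∣ coeff e f := by
  constructor
  · rw [Ideal.mem_span_pair]
    rintro ⟨a, b, rfl⟩ e he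
    rw [map_add, X_pow_dvd_iff.1 (Dvd.intro_left b rfl) e he, add_zero]
    exact (natCast_dvd_iff n _).1 (Dvd.intro_left a rfl) e
  · intro h
    let g : MvPowerSeries σ R := fun e => if e i < M then coeff e f else 0
    have hg (e) : coeff e g = if e i < M then coeff e f else 0 := rfl
    rw [← add_sub_cancel g f]
    refine add_mem (Ideal.mem_of_dvd _ ?_ (Ideal.subset_span (Set.mem_insert _ _)))
      (Ideal.mem_of_dvd _ ?_ (Ideal.subset_span (Set.mem_insert_of_mem _ rfl)))
    · rw [natCast_dvd_iff]
      intro e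
      rw [hg]
      split_ifs with he
      exacts [h e he, dvd_zero _]
    · rw [X_pow_dvd_iff]
      intro e he
      rw [map_sub, hg, if_pos he, sub_self]

theorem coeff_subst_ite_eq {σ R : Type*} [CommRing R] [Finite σ] [DecidableEq σ] (i : σ)
    (f : MvPowerSeries σ R) (e : σ →₀ ℕ) (he : e i = 0) :
    coeff e (f.subst fun k => if k = i then (0 : MvPowerSeries σ R) else X k) = coeff e f := by
  have ha : HasSubst fun k => if k = i then (0 : MvPowerSeries σ R) else X k :=
    hasSubst_of_constantCoeff_zero fun k => by split_ifs <;> simp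
  have hX (d : σ →₀ ℕ) (hd : d i = 0) :
      (d.prod fun k n => (if k = i then (0 : MvPowerSeries σ R) else X k) ^ n) = monomial d 1 := by
    rw [monomial_one_eq]
    refine Finsupp.prod_congr fun k hk => ?_
    rw [if_neg]
    rintro rfl
    exact Finsupp.mem_support_iff.1 hk hd
  rw [coeff_subst ha, finsum_eq_single _ e]
  · rw [hX e he, coeff_monomial_same, smul_eq_mul, mul_one]
  · intro d hd
    by_cases hdi : d i = 0
    · rw [hX d hdi, coeff_monomial_ne hd.symm, smul_zero]
    · rw [Finsupp.prod, Finset.prod_eq_zero (Finsupp.mem_support_iff.2 hdi), map_zero, smul_zero]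
      rw [if_pos rfl, zero_pow hdi]

end MvPowerSeries

open MvPowerSeries in
-- These are the unit laws `F(0, y) = y` and `F(x, 0) = x`; `Fin.rev` exchanges the two variables,
-- so that both cases are treated together.
theorem FormalGroup.X_dvd_sub_X_rev {R : Type*} [CommRing R] (F : FormalGroup R) (i : Fin 2) :
    X i ∣ F.toPowerSeries - X i.rev := by
  rw [X_dvd_iff]
  intro e he
  rw [map_sub, sub_eq_zero, ← coeff_subst_ite_eq i _ e he]
  congr 1
  match i with
  | 0 =>
    convert F.zero_add (PowerSeries.HasSubst.X (1 : Fin 2)) using 2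
    · ext1 k; fin_cases k <;> simp
    · rfl
  | 1 =>
    convert F.add_zero (PowerSeries.HasSubst.X (0 : Fin 2)) using 2
    · ext1 k; fin_cases k <;> simp
    · rfl

/-! ### Putting `v_i = 0` for `i ≠ s`, and the denominators of the logarithm -/

namespace BP

/-- The ring endomorphism of `R[v_1, v_2, …]` that puts `v_i = 0` for all `i ≠ s`. -/
noncomputable def proj (R : Type*) [CommRing R] (s : ℕ) : MvPolynomial ℕ+ R →+* MvPolynomial ℕ+ R :=
  MvPolynomial.eval₂Hom MvPolynomial.C
    fun i : ℕ+ => if (i : ℕ) = s then MvPolynomial.X i else 0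

theorem proj_C {R : Type*} [CommRing R] (s : ℕ) (r : R) :
    proj R s (MvPolynomial.C r) = MvPolynomial.C r := by
  simp [proj]

theorem proj_v {R : Type*} [CommRing R] (s i : ℕ) (hi : 0 < i) :
    proj R s (v R i) = if i = s then v R i else 0 := by
  simp [proj, v, hi]

theorem proj_map {R S : Type*} [CommRing R] [CommRing S] (f : R →+* S) (s : ℕ) :
    (proj S s).comp (MvPolynomial.map f) = (MvPolynomial.map f).comp (proj R s) := by
  refine MvPolynomial.ringHom_ext (fun r => by simp [proj]) fun i => ?_
  by_cases h : (i : ℕ) = s <;> simp [proj, h]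

theorem proj_expand {R : Type*} [CommRing R] (s q : ℕ) (hq : q ≠ 0) (a : MvPolynomial ℕ+ R) :
    proj R s (MvPolynomial.expand q a) = MvPolynomial.expand q (proj R s a) := by
  have : (proj R s).comp ((MvPolynomial.expand q : MvPolynomial ℕ+ R →ₐ[R] MvPolynomial ℕ+ R) :
      MvPolynomial ℕ+ R →+* MvPolynomial ℕ+ R) = ((MvPolynomial.expand q :
      MvPolynomial ℕ+ R →ₐ[R] MvPolynomial ℕ+ R) : _ →+* _).comp (proj R s) := by
    refine MvPolynomial.ringHom_ext (fun r => by simp [proj]) fun i => ?_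
    by_cases h : (i : ℕ) = s <;> simp [proj, h, hq]
  exact RingHom.congr_fun this a

theorem lift_map_proj {R : Type*} [CommRing R] (s q : ℕ) (hq : q ≠ 0)
    (f : MvPowerSeries (Fin 2) (MvPolynomial ℕ+ R)) :
    lift R q hq (f.map (proj R s)) = (lift R q hq f).map (proj R s) := by
  rw [lift_apply, lift_apply, ← MvPowerSeries.map_expand, MvPowerSeries.map_map,
    MvPowerSeries.map_map]
  congr 2
  exact RingHom.ext fun x => (proj_expand s q hq x).symm

/-- In Hazewinkel's recursion only the summand `k = m - s`, the one with `v_s`, survives. -/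
theorem proj_logCoeff_eq (p s m : ℕ) [hp : Fact p.Prime] (hs : 0 < s) (hm : 0 < m) : proj ℚ s (logCoeff p m) =
    if s ≤ m then MvPolynomial.C (1 / (p : ℚ)) * (proj ℚ s (logCoeff p (m - s)) *
      v ℚ s ^ p ^ (m - s)) else 0 := by
  have h (k : ℕ) (hk : k ∈ Finset.range m) (hks : k + s ≠ m) : proj ℚ s (v ℚ (m - k)) = 0 := by
    rw [Finset.mem_range] at hk
    rw [proj_v _ _ (by omega), if_neg (by omega)]
  rw [logCoeff_eq p m hm, map_mul, proj_C, map_sum]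
  split_ifs with hsm
  · rw [Finset.sum_eq_single (m - s)]
    · rw [map_mul, map_pow, proj_v _ _ (by omega), if_pos (by omega), Nat.sub_sub_self hsm]
    · intro k hk hks
      rw [map_mul, map_pow, h k hk (by omega), zero_pow (pow_ne_zero _ hp.out.ne_zero), mul_zero]
    · intro hk
      exact absurd (Finset.mem_range.2 (by omega)) hk
  · rw [Finset.sum_eq_zero, mul_zero]
    intro k hk
    rw [map_mul, map_pow, h k hk (by omega), zero_pow (pow_ne_zero _ hp.out.ne_zero), mul_zero]

/-- Each factor `1 / p` lowers the index by `s ≥ 2`, so for `m > 0` one power of `p` is gained over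
the general bound `p ^ m`. This gain is what kills the terms `m ≥ 1` of the functional equation mod
`p`. -/
theorem pow_mul_proj_logCoeff_mem (p s m : ℕ) [hp : Fact p.Prime] (hs : 1 < s) (hm : 0 < m) :
    MvPolynomial.C ((p : ℚ) ^ (m - 1)) * proj ℚ s (logCoeff p m) ∈
      (MvPolynomial.map (σ := ℕ+) (Int.castRingHom ℚ)).range := by
  have hp0 : (p : ℚ) ≠ 0 := by exact_mod_cast hp.out.ne_zero
  have hC (k : ℕ) : (MvPolynomial.C ((p : ℚ) ^ k) : MvPolynomial ℕ+ ℚ) ∈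
      (MvPolynomial.map (σ := ℕ+) (Int.castRingHom ℚ)).range :=
    ⟨MvPolynomial.C ((p : ℤ) ^ k), by simp⟩
  have hv : v ℚ s ∈ (MvPolynomial.map (σ := ℕ+) (Int.castRingHom ℚ)).range :=
    ⟨v ℤ s, by simp [v]⟩
  induction m using Nat.strong_induction_on with
  | _ m ih =>
  rw [proj_logCoeff_eq p s m (by omega) hm]
  split_ifs with h
  · have key (c : ℕ) (hc : c + 2 ≤ m) : (MvPolynomial.C ((p : ℚ) ^ (m - 1)) : MvPolynomial ℕ+ ℚ) *
        MvPolynomial.C (1 / (p : ℚ)) = MvPolynomial.C ((p : ℚ) ^ (m - 2 - c)) *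
          MvPolynomial.C ((p : ℚ) ^ c) := by
      rw [← map_mul, ← map_mul, ← pow_add, show m - 1 = m - 2 - c + c + 1 by omega, pow_succ]
      congr 1
      field_simp
    -- The exponent `m - s - 1` is the one in the inductive hypothesis for `m - s`; if `m = s` it
    -- truncates to `0`, and `l_0 = 1` needs no power of `p`.
    rw [← mul_assoc, key (m - s - 1) (by omega), mul_assoc,
      ← mul_assoc (MvPolynomial.C ((p : ℚ) ^ (m - s - 1)))]
    refine mul_mem (hC _) (mul_mem ?_ (pow_mem hv _))
    rcases Nat.eq_zero_or_pos (m - s) with h0 | h0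
    · rw [h0, logCoeff, map_one, mul_one]
      exact hC _
    · exact ih _ (by omega) h0
  · rw [mul_zero]
    exact zero_mem _

theorem pow_mul_proj_logCoeff_mem' (p s m : ℕ) [hp : Fact p.Prime] :
    MvPolynomial.C ((p : ℚ) ^ m) * proj ℚ s (logCoeff p m) ∈
      (MvPolynomial.map (σ := ℕ+) (Int.castRingHom ℚ)).range := by
  obtain ⟨a, ha⟩ := pow_mul_logCoeff_mem p m
  refine ⟨proj ℤ s a, ?_⟩
  have := RingHom.congr_fun (proj_map (Int.castRingHom ℚ) s) a
  rw [RingHom.comp_apply, RingHom.comp_apply, ha, map_mul, proj_C] at this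
  exact this.symm

/-! ### The integral form of the group law and its functional equation -/

open MvPowerSeries

theorem exists_map_eq_formalGroupRat (p : ℕ) [Fact p.Prime] :
    ∃ G : FormalGroup (MvPolynomial ℕ+ ℤ),
      G.map (MvPolynomial.map (Int.castRingHom ℚ)) = formalGroupRat p :=
  FormalGroup.exists_map_eq (MvPolynomial.map_injective _ Int.cast_injective) _
    (coeff_formalGroupRat_mem p)

/-- A form of `F_BP` over `ℤ[v_1, v_2, …]`. -/
noncomputable def formalGroupInt (p : ℕ) [Fact p.Prime] : FormalGroup (MvPolynomial ℕ+ ℤ) :=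
  (exists_map_eq_formalGroupRat p).choose

theorem map_formalGroupInt (p : ℕ) [Fact p.Prime] :
    (formalGroupInt p).map (MvPolynomial.map (Int.castRingHom ℚ)) = formalGroupRat p :=
  (exists_map_eq_formalGroupRat p).choose_spec

/-- The formal group law over `ℤ[v_1, v_2, …]` obtained from `F_BP` by putting `v_i = 0` for all
`i ≠ s`. -/
noncomputable def formalGroupProj (p s : ℕ) [Fact p.Prime] : FormalGroup (MvPolynomial ℕ+ ℤ) :=
  (formalGroupInt p).map (proj ℤ s)

/-- This is the functional equation after putting `v_i = 0`, which leaves only `i = s` in the outer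
sum. The cutoff `n` depends on `e`, since the equation is known only up to terms of high order. -/
theorem coeff_map_formalGroupProj (p s : ℕ) [hp : Fact p.Prime] (hs : 0 < s) (e : Fin 2 →₀ ℕ) :
    ∃ n : ℕ, MvPolynomial.map (Int.castRingHom ℚ) (coeff e (formalGroupProj p s).toPowerSeries) =
      coeff e (X 0 + X 1 + ∑ m ∈ Finset.range (n + 1),
        C (MvPolynomial.C (1 / (p : ℚ)) * v ℚ s) *
          (C (MvPolynomial.expand (p ^ s) (proj ℚ s (logCoeff p m))) *
          ((lift ℤ (p ^ s) (pow_ne_zero s hp.out.ne_zero)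
            (formalGroupProj p s).toPowerSeries ^ p ^ m -
            ((formalGroupProj p s).toPowerSeries ^ p ^ s) ^ p ^ m).map
              (MvPolynomial.map (Int.castRingHom ℚ))))) := by
  have hF : (formalGroupProj p s).toPowerSeries.map (MvPolynomial.map (Int.castRingHom ℚ)) =
      (formalGroupRat p).toPowerSeries.map (proj ℚ s) := by
    rw [← map_formalGroupInt, formalGroupProj, FormalGroup.map_toPowerSeries,
      FormalGroup.map_toPowerSeries, MvPowerSeries.map_map, MvPowerSeries.map_map, proj_map]
  obtain ⟨n, hn⟩ : ∃ n, n = e.degree := ⟨_, rfl⟩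
  refine ⟨n, ?_⟩
  -- With cutoff `n + s`, the inner sum for `i = s` runs over `range (n + 1)`, and the error has
  -- order at least `p ^ (n + s + 1) > n = deg e`.
  have h := le_trans (order_sub_of_log_eq p (n + s) _ (formalGroupRat p).zero_constantCoeff
    (FormalGroup.log_subst_ofLog _ (constantCoeff_log p) (isUnit_coeff_one_log p)))
    (le_order_map (proj ℚ s))
  have h1 := coeff_of_lt_order (lt_of_lt_of_le (by
    rw [← hn]
    exact_mod_cast (Nat.lt_pow_self hp.out.one_lt).trans
      (Nat.pow_lt_pow_right hp.out.one_lt (by omega : n < n + s + 1))) h)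
  rw [map_sub, map_sub, sub_eq_zero, ← hF, coeff_map] at h1
  rw [h1]
  congr 1
  have hL : (lift ℚ (p ^ s) (pow_ne_zero s hp.out.ne_zero)
      (formalGroupRat p).toPowerSeries).map (proj ℚ s) =
      (lift ℤ (p ^ s) (pow_ne_zero s hp.out.ne_zero) (formalGroupProj p s).toPowerSeries).map
        (MvPolynomial.map (Int.castRingHom ℚ)) := by
    rw [← lift_map_proj, ← hF, lift_map]
  generalize (formalGroupProj p s).toPowerSeries = g at hF hL ⊢
  generalize (formalGroupRat p).toPowerSeries = F at hF hL ⊢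
  generalize lift ℤ (p ^ s) (pow_ne_zero s hp.out.ne_zero) g = g' at hL ⊢
  have h0 (i : ℕ) (hi : i ∈ Finset.Icc 1 (n + s)) (his : i ≠ s) :
      (C (MvPolynomial.C (1 / (p : ℚ)) * v ℚ i) : MvPowerSeries (Fin 2) _).map (proj ℚ s) = 0 := by
    rw [Finset.mem_Icc] at hi
    rw [MvPowerSeries.map_C, map_mul (proj ℚ s), proj_v _ _ (by omega), if_neg his,
      mul_zero, map_zero]
  have h1 : (C (MvPolynomial.C (1 / (p : ℚ)) * v ℚ s) : MvPowerSeries (Fin 2) _).map (proj ℚ s) =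
      C (MvPolynomial.C (1 / (p : ℚ)) * v ℚ s) := by
    rw [MvPowerSeries.map_C, map_mul (proj ℚ s), proj_C, proj_v _ _ hs, if_pos rfl]
  have h2 (m : ℕ) : (C (MvPolynomial.expand (p ^ s) (logCoeff p m)) :
      MvPowerSeries (Fin 2) _).map (proj ℚ s) =
      C (MvPolynomial.expand (p ^ s) (proj ℚ s (logCoeff p m))) := by
    rw [MvPowerSeries.map_C, proj_expand _ _ (pow_ne_zero s hp.out.ne_zero)]
  rw [map_add, map_add, map_X, map_X, map_sum, Finset.sum_eq_single s]
  · rw [map_mul, h1, map_sum, Nat.add_sub_cancel, Finset.mul_sum]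
    refine congrArg _ (Finset.sum_congr rfl fun m _ => ?_)
    rw [map_mul (MvPowerSeries.map (proj ℚ s)), h2]
    simp only [map_sub, map_pow, hL, hF]
  · intro i hi his
    rw [map_mul, h0 i hi his, zero_mul]
  · intro h
    rw [Finset.mem_Icc] at h
    omega

end BP

/-! ### First approximations to the group law, mod `p` and mod `p ^ 2` -/

namespace BP
open MvPowerSeries

theorem map_intCast_injective :
    Function.Injective (MvPolynomial.map (σ := ℕ+) (Int.castRingHom ℚ)) :=
  MvPolynomial.map_injective _ Int.cast_injective

theorem C_pow_mul_expand_mem (p c q : ℕ) {a : MvPolynomial ℕ+ ℚ}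
    (ha : MvPolynomial.C ((p : ℚ) ^ c) * a ∈
      (MvPolynomial.map (σ := ℕ+) (Int.castRingHom ℚ)).range) :
    MvPolynomial.C ((p : ℚ) ^ c) * MvPolynomial.expand q a ∈
      (MvPolynomial.map (σ := ℕ+) (Int.castRingHom ℚ)).range := by
  obtain ⟨b, hb⟩ := ha
  exact ⟨MvPolynomial.expand q b, by rw [MvPolynomial.map_expand, hb, map_mul,
    MvPolynomial.expand_C]⟩

/-- Count of powers of `p` in one term of the functional equation: `c` clear the denominator of `a`,
one cancels `1 / p`, and `k` remain. -/
theorem exists_map_eq_coeff_mul (p c k s M : ℕ) [hp : Fact p.Prime] (i : Fin 2)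
    {a : MvPolynomial ℕ+ ℚ} (ha : MvPolynomial.C ((p : ℚ) ^ c) * a ∈
      (MvPolynomial.map (σ := ℕ+) (Int.castRingHom ℚ)).range)
    {h : MvPowerSeries (Fin 2) (MvPolynomial ℕ+ ℤ)}
    (hh : h ∈ Ideal.span {(p : MvPowerSeries (Fin 2) (MvPolynomial ℕ+ ℤ)) ^ (c + 1 + k), X i ^ M})
    (e : Fin 2 →₀ ℕ) (he : e i < M) :
    ∃ z, MvPolynomial.map (Int.castRingHom ℚ) ((p : MvPolynomial ℕ+ ℤ) ^ k * z) =
      coeff e (C (MvPolynomial.C (1 / (p : ℚ)) * v ℚ s) *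
        (C a * h.map (MvPolynomial.map (Int.castRingHom ℚ)))) := by
  have hp0 : (p : ℚ) ≠ 0 := by exact_mod_cast hp.out.ne_zero
  obtain ⟨b, hb⟩ := ha
  rw [← Nat.cast_pow, mem_span_natCast_X_pow_iff] at hh
  obtain ⟨w, hw⟩ := hh e he
  have h1 : (MvPolynomial.C (1 / (p : ℚ)) : MvPolynomial ℕ+ ℚ) * p = 1 := by
    rw [← map_natCast (MvPolynomial.C : ℚ →+* MvPolynomial ℕ+ ℚ), ← map_mul,
      one_div_mul_cancel hp0, map_one]
  have h2 : MvPolynomial.map (Int.castRingHom ℚ) (v ℤ s) = v ℚ s := by simp [v]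
  refine ⟨v ℤ s * b * w, ?_⟩
  rw [coeff_C_mul, coeff_C_mul, coeff_map, hw]
  simp only [map_mul, map_pow, map_natCast, hb, h2, Nat.cast_pow]
  linear_combination (-(v ℚ s * a * (p : MvPolynomial ℕ+ ℚ) ^ (c + k) *
    MvPolynomial.map (Int.castRingHom ℚ) w)) * h1

theorem pow_dvd_sub_of_map_eq_add_sum (p k : ℕ) {a b : MvPolynomial ℕ+ ℤ} (S : Finset ℕ)
    {t : ℕ → MvPolynomial ℕ+ ℚ}
    (h : MvPolynomial.map (Int.castRingHom ℚ) a =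
      MvPolynomial.map (Int.castRingHom ℚ) b + ∑ m ∈ S, t m)
    (ht : ∀ m, ∃ z, MvPolynomial.map (Int.castRingHom ℚ) ((p : MvPolynomial ℕ+ ℤ) ^ k * z) = t m) :
    (p : MvPolynomial ℕ+ ℤ) ^ k ∣ a - b := by
  choose z hz using ht
  refine ⟨∑ m ∈ S, z m, map_intCast_injective ?_⟩
  rw [Finset.mul_sum, map_sub, h, map_sum, add_sub_cancel_left]
  exact Finset.sum_congr rfl fun m _ => (hz m).symm

/-- The summand `m = 0` of the functional equation is `v_s D`. For `m ≥ 1` the total denominator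
divides `p ^ m`, while the difference of `p ^ m`-th powers is divisible by `p ^ (m + 1)`. -/
theorem exists_formalGroupProj_eq (p s : ℕ) [hp : Fact p.Prime] (hs : 1 < s) :
    ∃ D : MvPowerSeries (Fin 2) (MvPolynomial ℕ+ ℤ),
      lift ℤ (p ^ s) (pow_ne_zero s hp.out.ne_zero) (formalGroupProj p s).toPowerSeries -
        (formalGroupProj p s).toPowerSeries ^ p ^ s = p * D ∧
      (p : MvPowerSeries (Fin 2) (MvPolynomial ℕ+ ℤ)) ∣
        (formalGroupProj p s).toPowerSeries - (X 0 + X 1 + C (v ℤ s) * D) := by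
  have hdvd := dvd_lift_sub_pow p s (pow_ne_zero s hp.out.ne_zero)
    (formalGroupProj p s).toPowerSeries
  obtain ⟨D, hD⟩ := id hdvd
  refine ⟨D, hD, ?_⟩
  rw [natCast_dvd_iff]
  intro e
  obtain ⟨n, hn⟩ := coeff_map_formalGroupProj p s (by omega) e
  have h0 : C (MvPolynomial.C (1 / (p : ℚ)) * v ℚ s) *
      (C (MvPolynomial.expand (p ^ s) (proj ℚ s (logCoeff p 0))) *
        ((lift ℤ (p ^ s) (pow_ne_zero s hp.out.ne_zero)
            (formalGroupProj p s).toPowerSeries ^ p ^ 0 -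
            ((formalGroupProj p s).toPowerSeries ^ p ^ s) ^ p ^ 0).map
              (MvPolynomial.map (Int.castRingHom ℚ)))) =
      (C (v ℤ s) * D).map (MvPolynomial.map (Int.castRingHom ℚ)) := by
    have hp0 : (p : ℚ) ≠ 0 := by exact_mod_cast hp.out.ne_zero
    have h1 : (C (MvPolynomial.C (1 / (p : ℚ))) : MvPowerSeries (Fin 2) (MvPolynomial ℕ+ ℚ)) * p
        = 1 := by
      rw [← map_natCast (C : MvPolynomial ℕ+ ℚ →+* MvPowerSeries (Fin 2) (MvPolynomial ℕ+ ℚ)),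
        ← map_mul, ← map_natCast (MvPolynomial.C : ℚ →+* MvPolynomial ℕ+ ℚ), ← map_mul,
        one_div_mul_cancel hp0, map_one, map_one]
    have h2 : MvPolynomial.map (Int.castRingHom ℚ) (v ℤ s) = v ℚ s := by simp [v]
    rw [pow_zero, pow_one, pow_one, hD, logCoeff, map_one, map_one, map_one, one_mul,
      map_mul (MvPowerSeries.map _), map_mul (MvPowerSeries.map _), MvPowerSeries.map_C, h2,
      map_natCast, map_mul C]
    linear_combination (C (v ℚ s) * D.map (MvPolynomial.map (Int.castRingHom ℚ))) * h1
  rw [Finset.sum_range_succ', h0, add_comm (Finset.sum _ _), ← add_assoc, map_add, map_sum] at hn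
  rw [map_sub, ← pow_one (p : MvPolynomial ℕ+ ℤ)]
  have hb : X 0 + X 1 + (C (v ℤ s) * D).map (MvPolynomial.map (Int.castRingHom ℚ)) =
      (X 0 + X 1 + C (v ℤ s) * D).map (MvPolynomial.map (Int.castRingHom ℚ)) := by
    rw [map_add (MvPowerSeries.map _), map_add (MvPowerSeries.map _), map_X, map_X]
  rw [hb, coeff_map] at hn
  -- The summation index is now `m + 1`. Only powers of `p` matter here, so any truncation bound
  -- above `e 0` serves.
  refine pow_dvd_sub_of_map_eq_add_sum p 1 (Finset.range n) hn fun m =>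
    exists_map_eq_coeff_mul p m 1 s (e 0 + 1) 0
      (C_pow_mul_expand_mem p m _ (pow_mul_proj_logCoeff_mem p s (m + 1) hs m.succ_pos)) ?_ e
      (Nat.lt_succ_self _)
  exact Ideal.mem_of_dvd _ (dvd_sub_pow_of_dvd_sub hdvd (m + 1))
    (Ideal.subset_span (Set.mem_insert _ _))

theorem pow_dvd_lift_formalGroupProj_sub (p s : ℕ) [hp : Fact p.Prime] (i : Fin 2) :
    X i ^ p ^ s ∣ lift ℤ (p ^ s) (pow_ne_zero s hp.out.ne_zero)
      (formalGroupProj p s).toPowerSeries - X i.rev ^ p ^ s := by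
  have := map_dvd (lift ℤ (p ^ s) (pow_ne_zero s hp.out.ne_zero))
    ((formalGroupProj p s).X_dvd_sub_X_rev i)
  rwa [map_sub, lift_X, lift_X] at this

/-- In the `m`-th summand both powers are close to `X i.rev ^ p ^ (s + m)`, by the unit law.
Allowing `X i ^ p ^ (s - 2)` in the ideal gives `p ^ (m + 3)`, hence `p ^ 2` after division by `p ^
(m + 1)`; here the general bound on denominators is enough. -/
theorem formalGroupProj_sub_mem (p s : ℕ) [hp : Fact p.Prime] (hs : 1 < s) (i : Fin 2) :
    (formalGroupProj p s).toPowerSeries - (X 0 + X 1) ∈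
      Ideal.span {(p : MvPowerSeries (Fin 2) (MvPolynomial ℕ+ ℤ)) ^ 2, X i ^ p ^ (s - 2)} := by
  rw [← Nat.cast_pow, mem_span_natCast_X_pow_iff]
  intro e he
  obtain ⟨n, hn⟩ := coeff_map_formalGroupProj p s (by omega) e
  rw [map_add, map_sum] at hn
  rw [map_sub, Nat.cast_pow]
  have hb : (X 0 + X 1 : MvPowerSeries (Fin 2) (MvPolynomial ℕ+ ℚ)) =
      (X 0 + X 1 : MvPowerSeries (Fin 2) (MvPolynomial ℕ+ ℤ)).map
        (MvPolynomial.map (Int.castRingHom ℚ)) := by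
    rw [map_add (MvPowerSeries.map _), map_X, map_X]
  rw [hb, coeff_map] at hn
  refine pow_dvd_sub_of_map_eq_add_sum p 2 (Finset.range (n + 1)) hn fun m =>
    exists_map_eq_coeff_mul p m 2 s (p ^ (s - 2)) i
      (C_pow_mul_expand_mem p m _ (pow_mul_proj_logCoeff_mem' p s m)) ?_ e he
  have h1 := pow_prime_pow_sub_mem_span hp.out (by omega : s - 2 ≤ s + m) 1
    (by simpa using (formalGroupProj p s).X_dvd_sub_X_rev i)
  have h2 := (pow_dvd_lift_formalGroupProj_sub p s i).trans (sub_dvd_pow_sub_pow _ _ (p ^ m))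
  rw [one_mul, show s + m - (s - 2) + 1 = m + 1 + 2 by omega] at h1
  rw [← pow_mul, ← pow_add] at h2 ⊢
  rw [← sub_sub_sub_cancel_right _ _ (X i.rev ^ p ^ (s + m))]
  refine sub_mem (Ideal.mem_of_dvd _ ?_ (Ideal.subset_span (Set.mem_insert_of_mem _ rfl))) h1
  exact (pow_dvd_pow _ (Nat.pow_le_pow_right hp.out.pos (by omega))).trans h2

end BP

/-! ### The congruence over `ℤ[v_s]` -/

namespace BP
open MvPowerSeries

theorem mem_span_of_natCast_mul_mem (p M : ℕ) [hp : Fact p.Prime] (i : Fin 2)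
    {f : MvPowerSeries (Fin 2) (MvPolynomial ℕ+ ℤ)}
    (h : p * f ∈ Ideal.span {(p : MvPowerSeries (Fin 2) (MvPolynomial ℕ+ ℤ)) ^ 2, X i ^ M}) :
    f ∈ Ideal.span {(p : MvPowerSeries (Fin 2) (MvPolynomial ℕ+ ℤ)), X i ^ M} := by
  rw [← Nat.cast_pow, mem_span_natCast_X_pow_iff] at h
  rw [mem_span_natCast_X_pow_iff]
  intro e he
  have hp0 : (p : MvPolynomial ℕ+ ℤ) ≠ 0 := Nat.cast_ne_zero.2 hp.out.ne_zero
  have := h e he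
  rwa [← map_natCast (C : MvPolynomial ℕ+ ℤ →+* MvPowerSeries (Fin 2) (MvPolynomial ℕ+ ℤ)),
    coeff_C_mul, Nat.cast_pow, sq, mul_dvd_mul_iff_left hp0] at this

/-- The congruence for `F(x, y)`, over `ℤ[v_s]`. -/
theorem formalGroupProj_sub_mem_span (p s : ℕ) [hp : Fact p.Prime] (hs : 1 < s) (i : Fin 2) :
    (formalGroupProj p s).toPowerSeries - (X 0 + X 1 - C (v ℤ s) * ∑ j ∈ Finset.Ioo 0 p,
      ((p.choose j / p : ℕ) : MvPowerSeries (Fin 2) (MvPolynomial ℕ+ ℤ)) *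
        (X 0 ^ p ^ (s - 1)) ^ j * (X 1 ^ p ^ (s - 1)) ^ (p - j)) ∈
      Ideal.span {(p : MvPowerSeries (Fin 2) (MvPolynomial ℕ+ ℤ)), X i ^ p ^ (2 * (s - 1))} := by
  obtain ⟨D, hD, hg⟩ := exists_formalGroupProj_eq p s hs
  have hB := formalGroupProj_sub_mem p s hs i
  have hX := (formalGroupProj p s).X_dvd_sub_X_rev i
  have hL := pow_dvd_lift_formalGroupProj_sub p s i
  have hW := sq_dvd_add_pow_prime_pow_sub hp.out (s - 1)
    (X 0 : MvPowerSeries (Fin 2) (MvPolynomial ℕ+ ℤ)) (X 1)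
  rw [show s - 1 + 1 = s by omega] at hW
  generalize (∑ j ∈ Finset.Ioo 0 p,
      ((p.choose j / p : ℕ) : MvPowerSeries (Fin 2) (MvPolynomial ℕ+ ℤ)) *
        (X 0 ^ p ^ (s - 1)) ^ j * (X 1 ^ p ^ (s - 1)) ^ (p - j)) = W at hW ⊢
  generalize (formalGroupProj p s).toPowerSeries = g at hD hg hB hX hL ⊢
  -- Both terms of `p D` are compared with `X i.rev ^ p ^ s`, now with `t = s - 1`, which leaves
  -- exactly `p ^ 2`.
  have hDm : D ∈ Ideal.span {(p : MvPowerSeries (Fin 2) (MvPolynomial ℕ+ ℤ)),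
      X i ^ p ^ (s - 1)} := by
    apply mem_span_of_natCast_mul_mem
    rw [← hD, ← sub_sub_sub_cancel_right _ _ (X i.rev ^ p ^ s)]
    refine sub_mem (Ideal.mem_of_dvd _ ((pow_dvd_pow _ (Nat.pow_le_pow_right hp.out.pos
      (by omega))).trans hL) (Ideal.subset_span (Set.mem_insert_of_mem _ rfl))) ?_
    have := pow_prime_pow_sub_mem_span hp.out (by omega : s - 1 ≤ s) 1 (by simpa using hX)
    rwa [one_mul, show s - (s - 1) + 1 = 2 by omega] at this
  -- `lift` turns the exponent `p ^ (s - 2)` of `hB` into `p ^ (s + (s - 2)) = p ^ (2 * (s - 1))`.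
  have h1 : lift ℤ (p ^ s) (pow_ne_zero s hp.out.ne_zero) g - (X 0 ^ p ^ s + X 1 ^ p ^ s) ∈
      Ideal.span {(p : MvPowerSeries (Fin 2) (MvPolynomial ℕ+ ℤ)) ^ 2,
        X i ^ p ^ (2 * (s - 1))} := by
    obtain ⟨a, b, hab⟩ := Ideal.mem_span_pair.1 hB
    have := congrArg (lift ℤ (p ^ s) (pow_ne_zero s hp.out.ne_zero)) hab
    simp only [map_add, map_sub, map_mul, map_pow, map_natCast, lift_X] at this
    rw [← pow_mul, ← pow_add, show s + (s - 2) = 2 * (s - 1) by omega] at this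
    exact Ideal.mem_span_pair.2 ⟨_, _, this⟩
  -- Modulo `p`, `g` differs from `X 0 + X 1` by a multiple of `X i ^ p ^ (s - 1)`. The `p ^ s`-th
  -- power improves `p` to `p ^ (s + 1)`, and `t = s - 1` yields `p ^ 2` together with `X i ^ (p ^
  -- (s - 1) * p ^ (s - 1))`.
  have h2 : g ^ p ^ s - (X 0 + X 1) ^ p ^ s ∈
      Ideal.span {(p : MvPowerSeries (Fin 2) (MvPolynomial ℕ+ ℤ)) ^ 2,
        X i ^ p ^ (2 * (s - 1))} := by
    obtain ⟨a, b, hab⟩ := Ideal.mem_span_pair.1 hDm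
    obtain ⟨r, hr⟩ := hg
    have hu : (p : MvPowerSeries (Fin 2) (MvPolynomial ℕ+ ℤ)) ∣
        g - (X 0 + X 1 + C (v ℤ s) * b * X i ^ p ^ (s - 1)) :=
      ⟨r + C (v ℤ s) * a, by rw [← hab] at hr; linear_combination hr⟩
    rw [← sub_add_sub_cancel _ ((X 0 + X 1 + C (v ℤ s) * b * X i ^ p ^ (s - 1)) ^ p ^ s)]
    refine add_mem (Ideal.mem_of_dvd _ ((pow_dvd_pow _ (by omega)).trans
      (dvd_sub_pow_of_dvd_sub hu s)) (Ideal.subset_span (Set.mem_insert _ _))) ?_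
    have := pow_prime_pow_sub_mem_span hp.out (by omega : s - 1 ≤ s) (p ^ (s - 1))
      (show X i ^ p ^ (s - 1) ∣ X 0 + X 1 + C (v ℤ s) * b * X i ^ p ^ (s - 1) - (X 0 + X 1) from
        ⟨C (v ℤ s) * b, by ring⟩)
    rwa [← pow_add, show s - (s - 1) + 1 = 2 by omega, ← two_mul] at this
  -- By `h1`, `h2` and `hW`, `p D ≡ X 0 ^ p ^ s + X 1 ^ p ^ s - (X 0 + X 1) ^ p ^ s ≡ -p W` mod `p ^
  -- 2` and the power of `X i`; then divide by `p`.
  have h3 : D + W ∈ Ideal.span {(p : MvPowerSeries (Fin 2) (MvPolynomial ℕ+ ℤ)),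
      X i ^ p ^ (2 * (s - 1))} := by
    apply mem_span_of_natCast_mul_mem
    convert sub_mem (sub_mem h1 h2)
      (Ideal.mem_of_dvd _ hW (Ideal.subset_span (Set.mem_insert _ _))) using 1
    linear_combination -hD
  convert add_mem (Ideal.mem_of_dvd _ hg (Ideal.subset_span (Set.mem_insert _ _)))
    (Ideal.mul_mem_left _ (C (v ℤ s)) h3) using 1
  ring

/-! ### Passage to Morava K-theory -/

theorem formalGroup_eq_map (p : ℕ) [Fact p.Prime] :
    formalGroup p = (formalGroupInt p).map (MvPolynomial.map (algebraMap ℤ (Zloc p))) := by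
  refine (existsUnique_formalGroup p).unique (existsUnique_formalGroup p).choose_spec.1 ?_
  rw [← map_formalGroupInt]
  refine FormalGroup.ext ?_
  simp only [FormalGroup.map_toPowerSeries, MvPowerSeries.map_map]
  congr 2
  exact MvPolynomial.ringHom_ext (fun r => by simp) fun i => by simp

end BP

/-- The ring homomorphism `ℤ[v_1, v_2, …] → 𝔽_p[v_s, v_s⁻¹]` with `v_i ↦ 0` for `i ≠ s`. -/
noncomputable def MoravaK.ofInt (p s : ℕ) : MvPolynomial ℕ+ ℤ →+* MoravaK.CoeffRing p :=
  MvPolynomial.eval₂Hom (Int.castRingHom _) fun i : ℕ+ => if (i : ℕ) = s then MoravaK.v p else 0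

open MvPowerSeries in
theorem MoravaK.toPowerSeries_formalGroup (p s : ℕ) [Fact p.Prime] :
    (MoravaK.formalGroup p s).toPowerSeries =
      (BP.formalGroupProj p s).toPowerSeries.map (MoravaK.ofInt p s) := by
  rw [MoravaK.formalGroup, GTheory.formalGroup, BP.formalGroup_eq_map, BP.formalGroupProj]
  simp only [FormalGroup.map_toPowerSeries, MvPowerSeries.map_map]
  congr 2
  refine MvPolynomial.ringHom_ext (fun r => by simp) fun i => ?_
  by_cases h : (i : ℕ) = s <;> simp [MoravaK.ofInt, BP.proj, h]

theorem mainTheorem6 (p : ℕ) [Fact p.Prime] (s : ℕ) (hs : 1 < s) :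
    let x : MvPowerSeries (Fin 2) (MoravaK.CoeffRing p) := MvPowerSeries.X 0
    let y : MvPowerSeries (Fin 2) (MoravaK.CoeffRing p) := MvPowerSeries.X 1
    let F : MvPowerSeries (Fin 2) (MoravaK.CoeffRing p) := (MoravaK.formalGroup p s).toPowerSeries
    let A : MvPowerSeries (Fin 2) (MoravaK.CoeffRing p) :=
      x + y - MvPowerSeries.C (MoravaK.v p) * ∑ j ∈ Finset.Ioo 0 p,
        ((p.choose j / p : ℕ) : MvPowerSeries (Fin 2) (MoravaK.CoeffRing p)) *
          (x ^ p ^ (s - 1)) ^ j * (y ^ p ^ (s - 1)) ^ (p - j)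
    F - A ∈ Ideal.span {x ^ p ^ (2 * (s - 1))} ∧
      F - A ∈ Ideal.span {y ^ p ^ (2 * (s - 1))} := by
  intro x y F A
  have key (i : Fin 2) : F - A ∈ Ideal.span {MvPowerSeries.X i ^ p ^ (2 * (s - 1))} := by
    obtain ⟨a, b, hab⟩ := Ideal.mem_span_pair.1 (BP.formalGroupProj_sub_mem_span p s hs i)
    have h := congrArg (MvPowerSeries.map (MoravaK.ofInt p s)) hab
    have hv : MoravaK.ofInt p s (BP.v ℤ s) = MoravaK.v p := by
      simp [MoravaK.ofInt, BP.v, show 0 < s by omega]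
    -- In characteristic `p` the generator `p` of the ideal vanishes, which leaves only the power of
    -- `X i`.
    have hp : (p : MvPowerSeries (Fin 2) (MoravaK.CoeffRing p)) = 0 := by
      rw [← map_natCast ((MvPowerSeries.C).comp (LaurentPolynomial.C : ZMod p →+* _)),
        CharP.cast_eq_zero, map_zero]
    simp only [map_add, map_sub, map_mul, map_pow, map_sum, map_natCast, MvPowerSeries.map_X,
      MvPowerSeries.map_C, hv, hp, mul_zero, zero_add] at h
    rw [Ideal.mem_span_singleton']
    refine ⟨_, h.trans ?_⟩
    rw [← MoravaK.toPowerSeries_formalGroup]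
  exact ⟨key 0, key 1⟩
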